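/- Let $n,M,I,\ell\in\mathbb N$, let $\Xi\subset\mathbb R^{d_1}\times\dots\times\mathbb R^{d_n}$ be closed, where each factor $\mathbb R^{d_k}$ carries an arbitrary norm $\|\cdot\|$, and let $\mathcal X\subset\mathbb R^\ell$ be closed and convex. Let $p\ge1$, $\varepsilon_1,\dots,\varepsilon_n>0$, and let $Q=\sum_{l=1}^M\vartheta_l\delta_{\xi^l}$ be a discrete probability distribution with atoms $\xi^l\in\Xi$ and masses $\vartheta_l>0$, $\sum_l\vartheta_l=1$. The multi-transport hyperrectangle (MTH) is $$\mathcal T_p(Q,\boldsymbol\varepsilon)=\Big\{\mathrm{pr}_{2\#}\pi:\ \pi\in\mathcal P(\Xi\times\Xi),\ \mathrm{pr}_{1\#}\pi=Q,\ \int_{\Xi\times\Xi}\|\zeta_k-\xi_k\|^p\,d\pi(\zeta,\xi)\le\varepsilon_k^p\ \text{ for all } k\in\{1,\dots,n\}\Big\}.$$ Let $f_i:\mathcal X\times\Xi\to\mathbb R$ and $\alpha_i\in(0,1)$, $i=1,\dots,I$, be such that $x\mapsto f_i(x,\xi)$ is convex on $\mathcal X$ for every $\xi\in\Xi$, and, for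 some $r\in[0,p)$ and all $i$ and $x\in\mathcal X$, the function $\xi\mapsto f_i(x,\xi)$ is continuous on $\Xi$ and satisfies $|f_i(x,\xi)|\le C(1+\|\xi-\zeta\|^r)$ on $\Xi$ for some $C>0$ and $\zeta\in\Xi$ (which may depend on $i$ and $x$; the norm here is any norm on $\mathbb R^{d_1}\times\dots\times\mathbb R^{d_n}$). (a) For every $i$, the feasible set of the distributionally robust CVaR constraint $$\Big\{x\in\mathcal X:\ \sup_{P\in\mathcal T_p(Q,\boldsymbol\varepsilon)}\ \inf_{\tau\in\mathbb R}\ \mathbb E_P\big[(f_i(x,\xi)+\tau)_+-\tau\alpha_i\big]\le0\Big\}$$ consists of exactly those $x\in\mathcal X$ for which there exist $\boldsymbol\lambda\in\mathbb R^n_{\ge0}$, $\tau\in\mathbb R$ and $s\in\mathbb R^M_{\ge0}$ with $$\sum_{k=1}^n\lambda_k\varepsilon_k^p+\sum_{l=1}^M\vartheta_ls_l\le\tau\alpha_i,\qquad \sup_{\xi\in\Xi}\Big\{f_i(x,\xi)+\tau-\sum_{k=1}^n\lambda_k\|\xi_k-\xi_k^l\|^p\Big\}\le s_l\quad\text{for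 all } l\in\{1,\dots,M\}.$$ These constraints are convex: the differences of their left- and right-hand sides are (extended-real-valued) convex functions of $(x,\boldsymbol\lambda,\tau,s)\in\mathcal X\times\mathbb R^n\times\mathbb R\times\mathbb R^M$. (b) Let $g\in\mathbb R^\ell$. The problem of minimizing $\langle g,x\rangle$ over all $x\in\mathcal X$ that satisfy the distributionally robust CVaR constraints in (a) for all $i$ simultaneously is equivalent to the program of minimizing $\langle g,x\rangle$ over all $x\in\mathcal X$, $\boldsymbol\lambda_i\in\mathbb R^n_{\ge0}$, $\tau_i\in\mathbb R$, $s_i\in\mathbb R^M_{\ge0}$, $i=1,\dots,I$, such that $$\sum_{k=1}^n\lambda_{ki}\varepsilon_k^p+\sum_{l=1}^M\vartheta_ls_{li}\le\tau_i\alpha_i,\qquad \sup_{\xi\in\Xi}\Big\{f_i(x,\xi)+\tau_i-\sum_{k=1}^n\lambda_{ki}\|\xi_k-\xi_k^l\|^p\Big\}\le s_{li}\quad\text{for all } l \text{ and } i.$$ That is, the feasible set of the first problem is the projection onto the $x$-coordinate of the feasible set of the second, the optimal values (in $[-\infty,+\infty]$) are equal, and $x$ is optimal for the first if and only if $(x,\boldsymbol\lambda,\tau,s)$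 is optimal for the second for some $(\boldsymbol\lambda,\tau,s)$. The feasible set of the second problem is convex. -/

import Mathlib

open MeasureTheory Set
open scoped ENNReal

noncomputable section

/-- The class `𝒢_r^up`: real functions `h` on a metric space with
`h ξ ≤ C (1 + ρ(ζ, ξ) ^ r)` for all `ξ`, for some `C > 0` and some point `ζ`. -/
def GrowthUp {Ω : Type*} [PseudoMetricSpace Ω] (r : ℝ) (h : Ω → ℝ) : Prop :=
  ∃ C : ℝ, 0 < C ∧ ∃ ζ : Ω, ∀ ξ : Ω, h ξ ≤ C * (1 + dist ζ ξ ^ r)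

/-- The class `𝒢_r`: both `h` and `-h` belong to `𝒢_r^up`. -/
def Growth {Ω : Type*} [PseudoMetricSpace Ω] (r : ℝ) (h : Ω → ℝ) : Prop :=
  GrowthUp r h ∧ GrowthUp r (fun ξ => -h ξ)

/-- The discrete measure `∑ l, ϑ l • δ_{a l}`. -/
def discreteMeasure {Ω : Type*} [MeasurableSpace Ω] {M : ℕ} (ϑ : Fin M → ℝ) (a : Fin M → Ω) :
    Measure Ω :=
  ∑ l, ENNReal.ofReal (ϑ l) • Measure.dirac (a l)

/-- The multi-transport hyperrectangle `𝒯_p(Q, ε)`: second marginals of probability measures `π`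
on `Ξ × Ξ` with first marginal `Q` and `∫ ‖ζ_k - ξ_k‖ ^ p dπ(ζ, ξ) ≤ ε_k ^ p` for every `k`. -/
def multiTransportHyperrectangle {n : ℕ} {E : Fin n → Type*}
    [∀ k, NormedAddCommGroup (E k)] [∀ k, MeasurableSpace (E k)]
    (Ξ : Set (∀ k, E k)) (p : ℝ) (Q : Measure Ξ) (ε : Fin n → ℝ) : Set (Measure Ξ) :=
  {P | ∃ π : Measure (Ξ × Ξ), IsProbabilityMeasure π ∧
      π.map Prod.fst = Q ∧ π.map Prod.snd = P ∧
      ∀ k, ∫⁻ z, ENNReal.ofReal (‖(z.1 : ∀ k, E k) k - (z.2 : ∀ k, E k) k‖ ^ p) ∂π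
        ≤ ENNReal.ofReal (ε k ^ p)}

/-- `E_P[(h(ξ) + τ)₊ - τ α]` for a probability measure `P`, as an extended real number: the
integral of the nonnegative function `(h + τ)₊` is the Lebesgue integral with values in `[0, ∞]`,
and the constant `τ α` is taken out of the expectation. -/
def cvarObjective {Ω : Type*} [MeasurableSpace Ω] (P : Measure Ω) (h : Ω → ℝ) (α τ : ℝ) : EReal :=
  ((∫⁻ ξ, ENNReal.ofReal (max (h ξ + τ) 0) ∂P : ℝ≥0∞) : EReal) - ((τ * α : ℝ) : EReal)

/-- `sup_{P ∈ 𝒯} inf_{τ ∈ ℝ} E_P[(h(ξ) + τ)₊ - τ α]`. -/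
def worstCaseCVaR {Ω : Type*} [MeasurableSpace Ω] (T : Set (Measure Ω)) (h : Ω → ℝ) (α : ℝ) :
    EReal :=
  ⨆ P ∈ T, ⨅ τ : ℝ, cvarObjective P h α τ

/-- `sup_{ξ ∈ Ξ} { h(ξ) + τ - ∑ k, λ_k ‖ξ_k - ζ_k‖ ^ p }`, an extended real number. -/
def penalizedSup {n : ℕ} {E : Fin n → Type*} [∀ k, NormedAddCommGroup (E k)]
    {Ξ : Set (∀ k, E k)} (p : ℝ) (h : Ξ → ℝ) (ζ : Ξ) (lam : Fin n → ℝ) (τ : ℝ) : EReal :=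
  ⨆ ξ : Ξ, ((h ξ + τ - ∑ k, lam k * ‖(ξ : ∀ k, E k) k - (ζ : ∀ k, E k) k‖ ^ p : ℝ) : EReal)

/-- The function `⟨λ, (ε_1^p, …, ε_n^p)⟩ + ∑ l, ϑ_l s_l - τ α`, nonpositive on the first
constraint. -/
def budgetFun {n M : ℕ} (p : ℝ) (ε : Fin n → ℝ) (ϑ : Fin M → ℝ) (α : ℝ)
    (lam : Fin n → ℝ) (τ : ℝ) (s : Fin M → ℝ) : ℝ :=
  ∑ k, lam k * ε k ^ p + ∑ l, ϑ l * s l - τ * α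

/-- The finite system of constraints on the variables `(λ, τ, s)` attached to the function
`h = f(x, ·)`. -/
def EpiConstraints {n M : ℕ} {E : Fin n → Type*} [∀ k, NormedAddCommGroup (E k)]
    {Ξ : Set (∀ k, E k)} (p : ℝ) (ε : Fin n → ℝ) (ϑ : Fin M → ℝ) (a : Fin M → Ξ) (α : ℝ)
    (h : Ξ → ℝ) (lam : Fin n → ℝ) (τ : ℝ) (s : Fin M → ℝ) : Prop :=
  (∀ k, 0 ≤ lam k) ∧ (∀ l, 0 ≤ s l) ∧
    ∑ k, lam k * ε k ^ p + ∑ l, ϑ l * s l ≤ τ * α ∧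
    ∀ l, penalizedSup p h (a l) lam τ ≤ (s l : EReal)

/-- Convexity of an extended-real-valued function on a set: its epigraph over the set is convex. -/
def EConvexOn {V : Type*} [AddCommGroup V] [Module ℝ V] (S : Set V) (φ : V → EReal) : Prop :=
  Convex ℝ {z : V × ℝ | z.1 ∈ S ∧ φ z.1 ≤ (z.2 : EReal)}

/-- `z` minimizes `φ` over the feasible set `S`. -/
def IsSolution {V : Type*} (S : Set V) (φ : V → ℝ) (z : V) : Prop :=
  z ∈ S ∧ ∀ w ∈ S, φ z ≤ φ w

/-- The optimal value `inf_{z ∈ S} φ(z)` (`+∞` if `S` is empty, `-∞` if unbounded below). -/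
def optValue {V : Type*} (S : Set V) (φ : V → ℝ) : EReal :=
  ⨅ z ∈ S, ((φ z : ℝ) : EReal)

/-- The feasible set of one distributionally robust CVaR constraint. -/
def cvarFeasibleSet {X Ω : Type*} [MeasurableSpace Ω] (𝒳 : Set X) (T : Set (Measure Ω))
    (f : X → Ω → ℝ) (α : ℝ) : Set X :=
  {x | x ∈ 𝒳 ∧ worstCaseCVaR T (f x) α ≤ 0}

/-- The feasible set of the problem with several distributionally robust CVaR constraints. -/
def drccpFeasibleSet {X Ω : Type*} [MeasurableSpace Ω] {I : ℕ} (𝒳 : Set X) (T : Set (Measure Ω))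
    (f : Fin I → X → Ω → ℝ) (α : Fin I → ℝ) : Set X :=
  {x | x ∈ 𝒳 ∧ ∀ i, worstCaseCVaR T (f i x) (α i) ≤ 0}

/-- The feasible set of the epigraphical program, in the variables `(x, λ, τ, s)`. -/
def epiFeasibleSet {X : Type*} {n M I : ℕ} {E : Fin n → Type*} [∀ k, NormedAddCommGroup (E k)]
    {Ξ : Set (∀ k, E k)} (𝒳 : Set X) (p : ℝ) (ε : Fin n → ℝ) (ϑ : Fin M → ℝ) (a : Fin M → Ξ)
    (f : Fin I → X → Ξ → ℝ) (α : Fin I → ℝ) :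
    Set (X × (Fin I → Fin n → ℝ) × (Fin I → ℝ) × (Fin I → Fin M → ℝ)) :=
  {z | z.1 ∈ 𝒳 ∧
    ∀ i, EpiConstraints p ε ϑ a (α i) (f i z.1) (z.2.1 i) (z.2.2.1 i) (z.2.2.2 i)}

end

/-! The equivalence is Lagrangian duality between transport plans and multipliers `(λ, τ)`, with
attained multipliers. Weak duality integrates the pointwise bound `(h + τ)₊ ≤ s_l + ∑ λ_k c_k`
against an arbitrary admissible plan.

For strong duality, finite mixtures of plans moving each atom `a l` to one point `σ l` suffice, so
no topology on measures is needed. Each `σ` has a Lagrangian, continuous and convex in `(λ, τ)`. A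
mixture of these has infimum at most `0`: if the mixed plan is admissible, take `λ = 0` and `τ`
nearly optimal for its second marginal; if it exceeds a budget, enlarge the corresponding
multiplier. `exists_convexCombination_ge` turns this into a common point where any finite family of
Lagrangians is at most `δ`. The Lagrangian of the plan `σ = a` has a compact sublevel set, since
`ε_k > 0` and `0 < α < 1`; the finite intersection property then gives one `(λ, τ)` for all `σ` with
`δ = 0`. Atoms move independently, so the bound over all `σ` splits into one supremum `s_l` per
atom. -/

/-! ### Separation and finite minimax -/

/-- A finite theorem of the alternative: if at every point of a convex set one of finitely many
convex functions is at least `δ`, then so is one convex combination of them on the whole set. -/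
theorem exists_convexCombination_ge {V J : Type*} [AddCommGroup V] [Module ℝ V] [Fintype J]
    {D : Set V} (hD : D.Nonempty) {L : J → V → ℝ} (hL : ∀ j, ConvexOn ℝ D (L j)) {δ : ℝ}
    (h : ∀ z ∈ D, ∃ j, δ ≤ L j z) :
    ∃ w : J → ℝ, (∀ j, 0 ≤ w j) ∧ ∑ j, w j = 1 ∧ ∀ z ∈ D, δ ≤ ∑ j, w j * L j z := by
  classical
  obtain ⟨z₀, hz₀⟩ := hD
  have hJ : Nonempty J := ⟨(h z₀ hz₀).choose⟩
  have hDc : Convex ℝ D := (hL hJ.some).1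
  -- The open orthant below `δ` misses the upward closure `B` of the image of `L`; the coordinates
  -- of a separating functional are the weights, up to normalization.
  set A : Set (J → ℝ) := Set.pi univ fun _ => Iio δ with hA
  set B : Set (J → ℝ) := {v | ∃ z ∈ D, ∀ j, L j z ≤ v j} with hB
  have hAc : Convex ℝ A := convex_pi fun _ _ => convex_Iio δ
  have hAo : IsOpen A := isOpen_set_pi finite_univ fun _ _ => isOpen_Iio
  have hBc : Convex ℝ B := by
    rintro v ⟨z, hz, hzv⟩ v' ⟨z', hz', hzv'⟩ s t hs ht hst
    refine ⟨s • z + t • z', hDc hz hz' hs ht hst, fun j => ?_⟩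
    refine ((hL j).2 hz hz' hs ht hst).trans ?_
    have h1 := mul_le_mul_of_nonneg_left (hzv j) hs
    have h2 := mul_le_mul_of_nonneg_left (hzv' j) ht
    simpa using add_le_add h1 h2
  have hAB : Disjoint A B := by
    rw [Set.disjoint_left]
    rintro v hv ⟨z, hz, hzv⟩
    obtain ⟨j, hj⟩ := h z hz
    exact absurd (hv j (mem_univ j)) (not_lt.2 (hj.trans (hzv j)))
  obtain ⟨F, u, hFA, hFB⟩ := geometric_hahn_banach_open hAc hAo hBc hAB
  set w : J → ℝ := fun j => F (Pi.single j 1) with hw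
  have hF : ∀ v : J → ℝ, F v = ∑ j, w j * v j := by
    intro v
    have := LinearMap.pi_apply_eq_sum_univ (F : (J → ℝ) →ₗ[ℝ] ℝ) v
    simp only [ContinuousLinearMap.coe_coe, smul_eq_mul] at this
    rw [this]
    refine Finset.sum_congr rfl fun j _ => ?_
    rw [mul_comm, hw]
    congr 3
    ext i
    simp [Pi.single_apply, eq_comm]
  have hw0 : ∀ j, 0 ≤ w j := by
    intro j
    by_contra! hj
    -- `B` is closed under increasing a coordinate, so a negative weight would make `F` unbounded
    -- below on it.
    have key : ∀ t : ℝ, 0 ≤ t → u ≤ F (fun i => L i z₀) + t * w j := by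
      intro t ht
      have hmem : (fun i => L i z₀) + t • (Pi.single j 1 : J → ℝ) ∈ B := by
        refine ⟨z₀, hz₀, fun i => ?_⟩
        have : 0 ≤ t * (Pi.single j 1 : J → ℝ) i :=
          mul_nonneg ht (by by_cases hij : i = j <;> simp [hij])
        simpa using this
      simpa [hw] using hFB _ hmem
    have h0 := key 0 le_rfl
    -- This `t` makes the bound read `u ≤ u - 1`.
    have h1 := key ((F (fun i => L i z₀) - u + 1) / (-w j))
      (div_nonneg (by linarith) (by linarith))
    rw [div_mul_eq_mul_div, div_neg, mul_div_assoc, div_self hj.ne] at h1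
    linarith
  have hu : ∀ η > 0, (δ - η) * ∑ j, w j < u := by
    intro η hη
    have := hFA (fun _ => δ - η) (fun j _ => by simpa using hη)
    rw [hF, ← Finset.sum_mul] at this
    linarith
  have hz : ∀ z ∈ D, u ≤ ∑ j, w j * L j z := fun z hz => by
    rw [← hF]
    exact hFB _ ⟨z, hz, fun j => le_rfl⟩
  have hpos : 0 < ∑ j, w j := by
    refine (Finset.sum_nonneg fun j _ => hw0 j).lt_of_ne fun h0 => ?_
    have hall := (Finset.sum_eq_zero_iff_of_nonneg fun j _ => hw0 j).1 h0.symm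
    have h1 := hu 1 one_pos
    have h2 := hz z₀ hz₀
    rw [Finset.sum_eq_zero fun j hj => by rw [hall j hj, zero_mul]] at h2
    rw [← h0] at h1
    linarith
  refine ⟨fun j => w j / ∑ i, w i, fun j => div_nonneg (hw0 j) hpos.le, ?_, fun z hzD => ?_⟩
  · rw [← Finset.sum_div, div_self hpos.ne']
  · simp_rw [div_mul_eq_mul_div]
    rw [← Finset.sum_div, le_div_iff₀ hpos]
    refine le_trans ?_ (hz z hzD)
    refine le_of_forall_pos_le_add fun η hη => ?_
    have := hu (η / ∑ j, w j) (div_pos hη hpos)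
    rw [sub_mul, div_mul_cancel₀ _ hpos.ne'] at this
    linarith

/-! ### The Lagrangian: convexity, coercivity, common multipliers -/

/-- The Lagrangian of the worst-case CVaR problem, in the multipliers `(λ, τ)`, at the transport
plan that moves the `l`-th atom to `σ l`. -/
def cvarLagrangian {Ω : Type*} {n M : ℕ} (b : Fin n → ℝ) (ϑ : Fin M → ℝ)
    (c : Fin n → Fin M → Ω → ℝ) (α : ℝ) (h : Ω → ℝ) (σ : Fin M → Ω) (z : (Fin n → ℝ) × ℝ) : ℝ :=
  ∑ k, z.1 k * b k + ∑ l, ϑ l * (max (h (σ l) + z.2) 0 - ∑ k, z.1 k * c k l (σ l)) - z.2 * α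

section Lagrangian

variable {Ω : Type*} {n M : ℕ} {b : Fin n → ℝ} {ϑ : Fin M → ℝ} {c : Fin n → Fin M → Ω → ℝ}
  {α : ℝ} {h : Ω → ℝ}

theorem continuous_cvarLagrangian (σ : Fin M → Ω) :
    Continuous (cvarLagrangian b ϑ c α h σ) := by
  unfold cvarLagrangian
  fun_prop

/-- Everything is affine in `(λ, τ)` except the positive parts, which are convex in `τ` and carry
weights `ϑ l ≥ 0`. -/
theorem convexOn_cvarLagrangian (hϑ : ∀ l, 0 ≤ ϑ l) (σ : Fin M → Ω) :
    ConvexOn ℝ {z : (Fin n → ℝ) × ℝ | 0 ≤ z.1} (cvarLagrangian b ϑ c α h σ) := by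
  refine ⟨(convex_Ici (0 : Fin n → ℝ)).linear_preimage (LinearMap.fst ℝ _ ℝ),
    fun z _ z' _ s t hs ht hst => ?_⟩
  have hmax : ∀ l, max (h (σ l) + (s * z.2 + t * z'.2)) 0 ≤
      s * max (h (σ l) + z.2) 0 + t * max (h (σ l) + z'.2) 0 := by
    intro l
    have h1 := mul_le_mul_of_nonneg_left (le_max_left (h (σ l) + z.2) 0) hs
    have h2 := mul_le_mul_of_nonneg_left (le_max_left (h (σ l) + z'.2) 0) ht
    refine max_le ?_ (by positivity)
    have : h (σ l) = s * h (σ l) + t * h (σ l) := by rw [← add_mul, hst, one_mul]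
    linarith
  have hlin : ∀ e : Fin n → ℝ, ∑ k, (s * z.1 k + t * z'.1 k) * e k =
      s * ∑ k, z.1 k * e k + t * ∑ k, z'.1 k * e k := by
    intro e
    rw [Finset.mul_sum, Finset.mul_sum, ← Finset.sum_add_distrib]
    exact Finset.sum_congr rfl fun k _ => by ring
  simp only [cvarLagrangian, Prod.fst_add, Prod.smul_fst, Prod.snd_add, Prod.smul_snd,
    Pi.add_apply, Pi.smul_apply, smul_eq_mul, hlin]
  have hsum : ∑ l, ϑ l * (max (h (σ l) + (s * z.2 + t * z'.2)) 0 -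
        (s * ∑ k, z.1 k * c k l (σ l) + t * ∑ k, z'.1 k * c k l (σ l))) ≤
      s * ∑ l, ϑ l * (max (h (σ l) + z.2) 0 - ∑ k, z.1 k * c k l (σ l)) +
        t * ∑ l, ϑ l * (max (h (σ l) + z'.2) 0 - ∑ k, z'.1 k * c k l (σ l)) := by
    rw [Finset.mul_sum, Finset.mul_sum, ← Finset.sum_add_distrib]
    refine Finset.sum_le_sum fun l _ => ?_
    have := mul_le_mul_of_nonneg_left (hmax l) (hϑ l)
    linarith
  linarith

/-- At the plan that does not move the atoms, the Lagrangian is coercive. -/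
theorem isCompact_sublevel_cvarLagrangian (hb : ∀ k, 0 < b k) (hϑ : ∀ l, 0 ≤ ϑ l)
    (hϑ1 : ∑ l, ϑ l = 1) (hα : 0 < α) (hα1 : α < 1) {a : Fin M → Ω}
    (hc : ∀ k l, c k l (a l) = 0) :
    IsCompact {z : (Fin n → ℝ) × ℝ | 0 ≤ z.1 ∧ cvarLagrangian b ϑ c α h a z ≤ 1} := by
  set H := ∑ l, ϑ l * h (a l) with hH
  -- Bounding the positive parts below by `H + τ` gives `τ ≤ R`; bounding them below by `0` gives `τ
  -- ≥ -1/α`. The bound on `λ` then follows from `τ ≤ R`.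
  set R := (1 - H) / (1 - α) with hR
  have hα' : 0 < 1 - α := by linarith
  have hclosed : IsClosed {z : (Fin n → ℝ) × ℝ | 0 ≤ z.1 ∧ cvarLagrangian b ϑ c α h a z ≤ 1} :=
    (isClosed_le continuous_const continuous_fst).inter
      (isClosed_le (continuous_cvarLagrangian a) continuous_const)
  refine (isCompact_Icc (a := ((0, -(1 / α)) : (Fin n → ℝ) × ℝ))
    (b := (fun k => (1 + R * α) / b k, R))).of_isClosed_subset hclosed ?_
  rintro ⟨lam, τ⟩ ⟨hlam, hL⟩
  simp only [cvarLagrangian, hc, mul_zero, Finset.sum_const_zero, sub_zero] at hL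
  have hterm : ∀ k, 0 ≤ lam k * b k := fun k => mul_nonneg (hlam k) (hb k).le
  have hsum : 0 ≤ ∑ k, lam k * b k := Finset.sum_nonneg fun k _ => hterm k
  have hm0 : 0 ≤ ∑ l, ϑ l * max (h (a l) + τ) 0 :=
    Finset.sum_nonneg fun l _ => mul_nonneg (hϑ l) (le_max_right _ _)
  have hm1 : H + τ ≤ ∑ l, ϑ l * max (h (a l) + τ) 0 := by
    have : H + τ = ∑ l, ϑ l * (h (a l) + τ) := by
      simp_rw [mul_add]
      rw [Finset.sum_add_distrib, ← Finset.sum_mul, hϑ1, one_mul]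
    rw [this]
    exact Finset.sum_le_sum fun l _ => mul_le_mul_of_nonneg_left (le_max_left _ _) (hϑ l)
  have hτR : τ ≤ R := by
    rw [hR, le_div_iff₀ hα']
    linarith
  refine ⟨⟨hlam, ?_⟩, ⟨fun k => ?_, hτR⟩⟩
  · change -(1 / α) ≤ τ
    rw [neg_le, ← sub_nonneg, ← mul_nonneg_iff_of_pos_right hα, sub_mul, div_mul_cancel₀ _ hα.ne']
    linarith
  · change lam k ≤ (1 + R * α) / b k
    rw [le_div_iff₀ (hb k)]
    have h1 := Finset.single_le_sum (fun k _ => hterm k) (Finset.mem_univ k)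
    have h2 := mul_le_mul_of_nonneg_right hτR hα.le
    linarith

/-- If every mixture of finitely many Lagrangians has nonpositive infimum, then all Lagrangians are
nonpositive at a common point. -/
theorem exists_forall_cvarLagrangian_nonpos (hb : ∀ k, 0 < b k) (hϑ : ∀ l, 0 ≤ ϑ l)
    (hϑ1 : ∑ l, ϑ l = 1) (hα : 0 < α) (hα1 : α < 1) {a : Fin M → Ω}
    (hc : ∀ k l, c k l (a l) = 0)
    (hmix : ∀ (T : Finset (Fin M → Ω)) (w : T → ℝ), (∀ σ, 0 ≤ w σ) → ∑ σ, w σ = 1 →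
      ∀ δ : ℝ, 0 < δ → ∃ z : (Fin n → ℝ) × ℝ, 0 ≤ z.1 ∧
        ∑ σ, w σ * cvarLagrangian b ϑ c α h σ z < δ) :
    ∃ z : (Fin n → ℝ) × ℝ, 0 ≤ z.1 ∧ ∀ σ, cvarLagrangian b ϑ c α h σ z ≤ 0 := by
  classical
  have hfin : ∀ (T : Finset (Fin M → Ω)) (δ : ℝ), 0 < δ →
      ∃ z : (Fin n → ℝ) × ℝ, 0 ≤ z.1 ∧ ∀ σ ∈ T, cvarLagrangian b ϑ c α h σ z ≤ δ := by
    intro T δ hδ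
    by_contra! hcon
    have hne : {z : (Fin n → ℝ) × ℝ | 0 ≤ z.1}.Nonempty := ⟨0, le_refl (0 : Fin n → ℝ)⟩
    have hconv : ∀ σ : T, ConvexOn ℝ {z : (Fin n → ℝ) × ℝ | 0 ≤ z.1}
        (cvarLagrangian b ϑ c α h (σ : Fin M → Ω)) := fun σ => convexOn_cvarLagrangian hϑ _
    have hge : ∀ z ∈ {z : (Fin n → ℝ) × ℝ | 0 ≤ z.1}, ∃ σ : T,
        δ ≤ cvarLagrangian b ϑ c α h (σ : Fin M → Ω) z := fun z hz =>
      let ⟨σ, hσ, hlt⟩ := hcon z hz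
      ⟨⟨σ, hσ⟩, hlt.le⟩
    obtain ⟨w, hw0, hw1, hw⟩ := exists_convexCombination_ge hne hconv hge
    obtain ⟨z, hz, hlt⟩ := hmix T w hw0 hw1 δ hδ
    exact absurd (hw z hz) (not_le.2 hlt)
  -- Indices pair a plan with a tolerance `1 / (N + 1)`. Adding `a` to each finite family keeps the
  -- point in the compact sublevel set; the largest `N` gives the strictest tolerance.
  obtain ⟨z, hz, hzall⟩ :=
    (isCompact_sublevel_cvarLagrangian (h := h) hb hϑ hϑ1 hα hα1 hc).inter_iInter_nonempty
      (fun i : (Fin M → Ω) × ℕ => {z | cvarLagrangian b ϑ c α h i.1 z ≤ 1 / ((i.2 : ℝ) + 1)})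
      (fun i => isClosed_le (continuous_cvarLagrangian i.1) continuous_const) (fun u => by
        obtain ⟨z, hz, hzT⟩ := hfin (insert a (u.image Prod.fst))
          (1 / (((u.sup Prod.snd : ℕ) : ℝ) + 1)) (by positivity)
        refine ⟨z, ⟨hz, (hzT a (Finset.mem_insert_self _ _)).trans ?_⟩, ?_⟩
        · rw [div_le_one (by positivity)]
          simp
        · simp only [mem_iInter]
          intro i hi
          refine (hzT i.1 (Finset.mem_insert_of_mem (Finset.mem_image_of_mem _ hi))).trans ?_
          have : (i.2 : ℝ) ≤ ((u.sup Prod.snd : ℕ) : ℝ) := by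
            exact_mod_cast Finset.le_sup (f := Prod.snd) hi
          exact one_div_le_one_div_of_le (by positivity) (by linarith))
  refine ⟨z, hz.1, fun σ => le_of_forall_pos_lt_add fun δ hδ => ?_⟩
  obtain ⟨N, hN⟩ := exists_nat_one_div_lt hδ
  have := mem_iInter.1 hzall (σ, N)
  rw [zero_add]
  exact lt_of_le_of_lt this hN

/-- The supremum of the Lagrangians splits into a supremum for each atom. -/
theorem exists_epigraph_of_cvarLagrangian_nonpos (hϑ : ∀ l, 0 < ϑ l) {a : Fin M → Ω}
    (hc : ∀ k l, c k l (a l) = 0)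
    {lam : Fin n → ℝ} {τ : ℝ} (hz : ∀ σ, cvarLagrangian b ϑ c α h σ (lam, τ) ≤ 0) :
    ∃ s : Fin M → ℝ, (∀ l, 0 ≤ s l) ∧ ∑ k, lam k * b k + ∑ l, ϑ l * s l ≤ τ * α ∧
      ∀ l ξ, h ξ + τ - ∑ k, lam k * c k l ξ ≤ s l := by
  classical
  set G : Fin M → Ω → ℝ := fun l ξ => max (h ξ + τ) 0 - ∑ k, lam k * c k l ξ with hG
  have hGa : ∀ l, 0 ≤ G l (a l) := fun l => by simp [hG, hc]
  have hz' : ∀ σ : Fin M → Ω, ∑ l, ϑ l * G l (σ l) ≤ τ * α - ∑ k, lam k * b k := fun σ => by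
    have := hz σ
    simp only [cvarLagrangian] at this
    simp only [hG]
    linarith
  have hbdd : ∀ l, BddAbove (range (G l)) := by
    intro l
    refine ⟨(τ * α - ∑ k, lam k * b k) / ϑ l, ?_⟩
    rintro _ ⟨ξ, rfl⟩
    rw [le_div_iff₀ (hϑ l)]
    -- Move only the `l`-th atom: the others contribute nonnegative terms, which can be dropped.
    refine le_trans ?_ (hz' (Function.update a l ξ))
    rw [← Finset.add_sum_erase _ _ (Finset.mem_univ l), Function.update_self, mul_comm]
    refine le_add_of_nonneg_right (Finset.sum_nonneg fun i hi => ?_)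
    rw [Function.update_of_ne (Finset.ne_of_mem_erase hi)]
    exact mul_nonneg (hϑ i).le (hGa i)
  refine ⟨fun l => ⨆ ξ, G l ξ, fun l => (hGa l).trans (le_ciSup (hbdd l) (a l)), ?_,
    fun l ξ => le_trans ?_ (le_ciSup (hbdd l) ξ)⟩
  · refine le_of_forall_pos_le_add fun δ hδ => ?_
    have hS : 0 ≤ ∑ l, ϑ l := Finset.sum_nonneg fun l _ => (hϑ l).le
    -- Near-maximizers for each atom, chosen separately, form one `σ`; the total weighted error is
    -- at most `δ`.
    have hη : 0 < δ / (∑ l, ϑ l + 1) := by positivity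
    have hch : ∀ l, ∃ ξ, (⨆ ξ, G l ξ) - δ / (∑ l, ϑ l + 1) < G l ξ := fun l =>
      have : Nonempty Ω := ⟨a l⟩
      exists_lt_of_lt_ciSup (by linarith)
    choose σ hσ using hch
    have h1 : ∑ l, ϑ l * (⨆ ξ, G l ξ) - (∑ l, ϑ l) * (δ / (∑ l, ϑ l + 1)) ≤
        ∑ l, ϑ l * G l (σ l) := by
      rw [Finset.sum_mul, ← Finset.sum_sub_distrib]
      refine Finset.sum_le_sum fun l _ => ?_
      rw [← mul_sub]
      exact mul_le_mul_of_nonneg_left (hσ l).le (hϑ l).le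
    have h2 : (∑ l, ϑ l) * (δ / (∑ l, ϑ l + 1)) ≤ δ := by
      rw [mul_div_assoc', div_le_iff₀ (by positivity)]
      nlinarith
    have := hz' σ
    linarith
  · exact sub_le_sub_right (le_max_left _ _) _

end Lagrangian

/-! ### Finitely supported transport plans -/

section Plans

variable {Ω Ω' J : Type*} [MeasurableSpace Ω] [MeasurableSpace Ω'] [Fintype J] {M : ℕ}

/-- The mixture, with weights `w`, of the plans that move the mass `ϑ l` from `a l` to `σ j l`. -/
noncomputable def mixedPlan (w : J → ℝ) (ϑ : Fin M → ℝ) (a : Fin M → Ω) (σ : J → Fin M → Ω') :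
    Measure (Ω × Ω') :=
  ∑ j, ENNReal.ofReal (w j) • ∑ l, ENNReal.ofReal (ϑ l) • Measure.dirac (a l, σ j l)

variable {w : J → ℝ} {ϑ : Fin M → ℝ} {a : Fin M → Ω} {σ : J → Fin M → Ω'}

theorem map_fst_mixedPlan (hw : ∀ j, 0 ≤ w j) (hw1 : ∑ j, w j = 1) :
    (mixedPlan w ϑ a σ).map Prod.fst = discreteMeasure ϑ a := by
  ext s hs
  have h1 : ∑ j, ENNReal.ofReal (w j) = 1 := by
    rw [← ENNReal.ofReal_sum_of_nonneg fun j _ => hw j, hw1, ENNReal.ofReal_one]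
  rw [Measure.map_apply measurable_fst hs]
  simp only [mixedPlan, discreteMeasure, Measure.coe_finsetSum, Finset.sum_apply,
    Measure.smul_apply, smul_eq_mul, Measure.dirac_apply' _ hs,
    Measure.dirac_apply' _ (measurable_fst hs)]
  change ∑ j, ENNReal.ofReal (w j) * ∑ l, ENNReal.ofReal (ϑ l) * s.indicator 1 (a l) = _
  rw [← Finset.sum_mul, h1, one_mul]

/-- Turns the costs and the objective of a mixed plan into the finite real sums that occur in the
mixed Lagrangian. -/
theorem lintegral_mixedPlan (hw : ∀ j, 0 ≤ w j) (hϑ : ∀ l, 0 ≤ ϑ l) {G : Ω × Ω' → ℝ}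
    (hG : Measurable G) (hG0 : ∀ z, 0 ≤ G z) :
    ∫⁻ z, ENNReal.ofReal (G z) ∂(mixedPlan w ϑ a σ) =
      ENNReal.ofReal (∑ j, w j * ∑ l, ϑ l * G (a l, σ j l)) := by
  simp only [mixedPlan, lintegral_finsetSum_measure, lintegral_smul_measure,
    lintegral_dirac' _ hG.ennreal_ofReal, smul_eq_mul]
  have hin : ∀ j, 0 ≤ ∑ l, ϑ l * G (a l, σ j l) := fun j =>
    Finset.sum_nonneg fun l _ => mul_nonneg (hϑ l) (hG0 _)
  rw [ENNReal.ofReal_sum_of_nonneg fun j _ => mul_nonneg (hw j) (hin j)]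
  refine Finset.sum_congr rfl fun j _ => ?_
  rw [ENNReal.ofReal_mul (hw j),
    ENNReal.ofReal_sum_of_nonneg fun l _ => mul_nonneg (hϑ l) (hG0 _)]
  congr 1
  exact Finset.sum_congr rfl fun l _ => (ENNReal.ofReal_mul (hϑ l)).symm

theorem isProbabilityMeasure_mixedPlan (hw : ∀ j, 0 ≤ w j) (hw1 : ∑ j, w j = 1)
    (hϑ : ∀ l, 0 ≤ ϑ l) (hϑ1 : ∑ l, ϑ l = 1) : IsProbabilityMeasure (mixedPlan w ϑ a σ) := by
  constructor
  have := lintegral_mixedPlan (a := a) (σ := σ) hw hϑ (G := fun _ => 1) measurable_const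
    fun _ => zero_le_one
  simpa [hϑ1, hw1] using this

end Plans

/-! ### Weak and strong duality -/

theorem penalizedSup_le_iff {n : ℕ} {E : Fin n → Type*} [∀ k, NormedAddCommGroup (E k)]
    {Ξ : Set (∀ k, E k)} {p : ℝ} {h : Ξ → ℝ} {ζ : Ξ} {lam : Fin n → ℝ} {τ t : ℝ} :
    penalizedSup p h ζ lam τ ≤ (t : EReal) ↔
      ∀ ξ : Ξ, h ξ + τ - ∑ k, lam k * ‖(ξ : ∀ k, E k) k - (ζ : ∀ k, E k) k‖ ^ p ≤ t := by
  simp only [penalizedSup, iSup_le_iff, EReal.coe_le_coe_iff]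

section Duality

variable {n M : ℕ} {E : Fin n → Type*} [∀ k, NormedAddCommGroup (E k)]
  [∀ k, NormedSpace ℝ (E k)] [∀ k, FiniteDimensional ℝ (E k)] [∀ k, MeasurableSpace (E k)]
  [∀ k, BorelSpace (E k)] {Ξ : Set (∀ k, E k)} {p : ℝ} {ε : Fin n → ℝ} {ϑ : Fin M → ℝ}
  {a : Fin M → Ξ} {α : ℝ} {h : Ξ → ℝ}

theorem measurable_norm_sub_rpow (p : ℝ) (k : Fin n) :
    Measurable fun z : Ξ × Ξ => ‖(z.1 : ∀ k, E k) k - (z.2 : ∀ k, E k) k‖ ^ p := by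
  have : SecondCountableTopology (E k) := by
    have : ProperSpace (E k) := FiniteDimensional.proper ℝ (E k)
    infer_instance
  have h1 : Measurable fun z : Ξ × Ξ => (z.1 : ∀ k, E k) k :=
    (measurable_pi_apply k).comp (measurable_subtype_coe.comp measurable_fst)
  have h2 : Measurable fun z : Ξ × Ξ => (z.2 : ∀ k, E k) k :=
    (measurable_pi_apply k).comp (measurable_subtype_coe.comp measurable_snd)
  exact (h1.sub h2).norm.pow_const p

/-- Weak duality. -/
theorem worstCaseCVaR_nonpos_of_epiConstraints (hh : Measurable h) (hϑ : ∀ l, 0 ≤ ϑ l)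
    {lam : Fin n → ℝ} {τ : ℝ} {s : Fin M → ℝ} (hε : ∀ k, 0 ≤ ε k)
    (hepi : EpiConstraints p ε ϑ a α h lam τ s) :
    worstCaseCVaR (multiTransportHyperrectangle Ξ p (discreteMeasure ϑ a) ε) h α ≤ 0 := by
  classical
  obtain ⟨hlam, hs, hbud, hpen⟩ := hepi
  refine iSup₂_le fun P hP => ?_
  obtain ⟨π, _, hfst, hsnd, hcost⟩ := hP
  refine (iInf_le _ τ).trans ?_
  have hmeas : Measurable fun ξ => ENNReal.ofReal (max (h ξ + τ) 0) :=
    ((hh.add_const τ).max measurable_const).ennreal_ofReal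
  -- The infimum copes with coinciding atoms, and the value `⊤` off the atoms makes the bound below
  -- hold everywhere, not just almost everywhere.
  set G : Ξ → ℝ≥0∞ := fun ζ => ⨅ l, if ζ = a l then ENNReal.ofReal (s l) else ⊤ with hG
  have hGm : Measurable G := Measurable.iInf fun l =>
    Measurable.ite (measurableSet_singleton (a l)) measurable_const measurable_const
  have hGa : ∀ l, G (a l) ≤ ENNReal.ofReal (s l) := fun l => (iInf_le _ l).trans (by simp)
  have hcm := fun k => (measurable_norm_sub_rpow (Ξ := Ξ) p k).ennreal_ofReal
  have hpt : ∀ z : Ξ × Ξ, ENNReal.ofReal (max (h z.2 + τ) 0) ≤ G z.1 +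
      ∑ k, ENNReal.ofReal (lam k) *
        ENNReal.ofReal (‖(z.1 : ∀ k, E k) k - (z.2 : ∀ k, E k) k‖ ^ p) := by
    intro z
    rw [hG, ENNReal.iInf_add]
    refine le_iInf fun l => ?_
    split_ifs with hl
    · have h0 : ∀ k, 0 ≤ lam k * ‖(z.1 : ∀ k, E k) k - (z.2 : ∀ k, E k) k‖ ^ p := fun k =>
        mul_nonneg (hlam k) (Real.rpow_nonneg (norm_nonneg _) p)
      simp_rw [← ENNReal.ofReal_mul (hlam _)]
      rw [← ENNReal.ofReal_sum_of_nonneg fun k _ => h0 k,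
        ← ENNReal.ofReal_add (hs l) (Finset.sum_nonneg fun k _ => h0 k)]
      refine ENNReal.ofReal_le_ofReal (max_le ?_ ?_)
      · have := penalizedSup_le_iff.1 (hpen l) z.2
        rw [hl]
        simp_rw [norm_sub_rev ((a l : ∀ k, E k) _)]
        linarith
      · exact add_nonneg (hs l) (Finset.sum_nonneg fun k _ => h0 k)
    · simp
  have hint : ∫⁻ ξ, ENNReal.ofReal (max (h ξ + τ) 0) ∂P ≤ ENNReal.ofReal (τ * α) := by
    calc ∫⁻ ξ, ENNReal.ofReal (max (h ξ + τ) 0) ∂P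
        = ∫⁻ z, ENNReal.ofReal (max (h z.2 + τ) 0) ∂π := by
          rw [← hsnd, lintegral_map hmeas measurable_snd]
      _ ≤ ∫⁻ z, (G z.1 + ∑ k, ENNReal.ofReal (lam k) *
            ENNReal.ofReal (‖(z.1 : ∀ k, E k) k - (z.2 : ∀ k, E k) k‖ ^ p)) ∂π :=
          lintegral_mono hpt
      _ = ∫⁻ ζ, G ζ ∂(discreteMeasure ϑ a) + ∑ k, ENNReal.ofReal (lam k) *
            ∫⁻ z, ENNReal.ofReal (‖(z.1 : ∀ k, E k) k - (z.2 : ∀ k, E k) k‖ ^ p) ∂π := by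
          rw [lintegral_add_left (show Measurable fun z : Ξ × Ξ => G z.1 from hGm.comp measurable_fst),
            lintegral_finsetSum _ fun k _ => (hcm k).const_mul _, ← hfst,
            lintegral_map hGm measurable_fst]
          congr 1
          exact Finset.sum_congr rfl fun k _ => lintegral_const_mul _ (hcm k)
      _ ≤ ∑ l, ENNReal.ofReal (ϑ l) * ENNReal.ofReal (s l) +
            ∑ k, ENNReal.ofReal (lam k) * ENNReal.ofReal (ε k ^ p) := by
          refine add_le_add ?_ (Finset.sum_le_sum fun k _ => mul_le_mul_right (hcost k) _)
          simp only [discreteMeasure, lintegral_finsetSum_measure, lintegral_smul_measure,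
            lintegral_dirac' _ hGm, smul_eq_mul]
          exact Finset.sum_le_sum fun l _ => mul_le_mul_right (hGa l) _
      _ = ENNReal.ofReal (∑ l, ϑ l * s l + ∑ k, lam k * ε k ^ p) := by
          have h0 : ∀ l, 0 ≤ ϑ l * s l := fun l => mul_nonneg (hϑ l) (hs l)
          have h1 : ∀ k, 0 ≤ lam k * ε k ^ p := fun k =>
            mul_nonneg (hlam k) (Real.rpow_nonneg (hε k) p)
          rw [ENNReal.ofReal_add (Finset.sum_nonneg fun l _ => h0 l)
            (Finset.sum_nonneg fun k _ => h1 k), ENNReal.ofReal_sum_of_nonneg fun l _ => h0 l,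
            ENNReal.ofReal_sum_of_nonneg fun k _ => h1 k]
          simp_rw [ENNReal.ofReal_mul (hϑ _), ENNReal.ofReal_mul (hlam _)]
      _ ≤ ENNReal.ofReal (τ * α) := ENNReal.ofReal_le_ofReal (by linarith)
  -- Ensures that `ENNReal.ofReal (τ * α)` is not truncated.
  have hτ : 0 ≤ τ * α := le_trans (add_nonneg
    (Finset.sum_nonneg fun k _ => mul_nonneg (hlam k) (Real.rpow_nonneg (hε k) p))
    (Finset.sum_nonneg fun l _ => mul_nonneg (hϑ l) (hs l))) hbud
  unfold cvarObjective
  have hE := EReal.coe_ennreal_le_coe_ennreal_iff.2 hint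
  rw [EReal.coe_ennreal_ofReal, max_eq_left hτ] at hE
  exact (EReal.sub_le_sub hE le_rfl).trans (by rw [← EReal.coe_sub, sub_self, EReal.coe_zero])

/-- Strong duality, with attainment of the multipliers. -/
theorem exists_epiConstraints_of_worstCaseCVaR_nonpos (hp : 0 < p) (hh : Measurable h)
    (hϑ : ∀ l, 0 < ϑ l) (hϑ1 : ∑ l, ϑ l = 1) (hε : ∀ k, 0 < ε k) (hα : 0 < α) (hα1 : α < 1)
    (hcvar : worstCaseCVaR (multiTransportHyperrectangle Ξ p (discreteMeasure ϑ a) ε) h α ≤ 0) :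
    ∃ (lam : Fin n → ℝ) (τ : ℝ) (s : Fin M → ℝ), EpiConstraints p ε ϑ a α h lam τ s := by
  classical
  set b : Fin n → ℝ := fun k => ε k ^ p with hb
  set c : Fin n → Fin M → Ξ → ℝ := fun k l ξ =>
    ‖(ξ : ∀ k, E k) k - (a l : ∀ k, E k) k‖ ^ p with hc
  have hb0 : ∀ k, 0 < b k := fun k => Real.rpow_pos_of_pos (hε k) p
  have hca : ∀ k l, c k l (a l) = 0 := fun k l => by
    simp [hc, Real.zero_rpow hp.ne']
  have hϑ0 : ∀ l, 0 ≤ ϑ l := fun l => (hϑ l).le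
  obtain ⟨⟨lam, τ⟩, hlam, hz⟩ := exists_forall_cvarLagrangian_nonpos (c := c) (h := h) hb0 hϑ0 hϑ1
    hα hα1 hca (fun T w hw hw1 δ hδ => by
      -- `A k` is the `k`-th transport cost of the mixed plan, `B τ` its expectation of `(h + τ)₊`.
      set A : Fin n → ℝ := fun k => ∑ σ : T, w σ * ∑ l, ϑ l * c k l ((σ : Fin M → Ξ) l) with hA
      set B : ℝ → ℝ := fun τ =>
        ∑ σ : T, w σ * ∑ l, ϑ l * max (h ((σ : Fin M → Ξ) l) + τ) 0 with hB
      have hsplit : ∀ z : (Fin n → ℝ) × ℝ, ∑ σ : T, w σ * cvarLagrangian b ϑ c α h σ z =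
          ∑ k, z.1 k * (b k - A k) + B z.2 - z.2 * α := by
        intro z
        have h1 : ∑ k, z.1 k * A k =
            ∑ σ : T, w σ * ∑ l, ϑ l * ∑ k, z.1 k * c k l ((σ : Fin M → Ξ) l) := by
          simp only [hA, Finset.mul_sum]
          rw [Finset.sum_comm]
          refine Finset.sum_congr rfl fun σ _ => ?_
          rw [Finset.sum_comm]
          exact Finset.sum_congr rfl fun l _ => Finset.sum_congr rfl fun k _ => by ring
        simp only [cvarLagrangian, mul_sub, mul_add, Finset.sum_sub_distrib,
          Finset.sum_add_distrib, ← Finset.sum_mul, hw1, one_mul, h1, hB]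
        ring
      by_cases hfeas : ∀ k, A k ≤ b k
      · have hmem : (mixedPlan w ϑ a fun σ : T => (σ : Fin M → Ξ)).map Prod.snd ∈
            multiTransportHyperrectangle Ξ p (discreteMeasure ϑ a) ε := by
          refine ⟨_, isProbabilityMeasure_mixedPlan hw hw1 hϑ0 hϑ1, map_fst_mixedPlan hw hw1, rfl,
            fun k => ?_⟩
          rw [lintegral_mixedPlan hw hϑ0 (measurable_norm_sub_rpow p k)
            fun z => Real.rpow_nonneg (norm_nonneg _) p]
          refine ENNReal.ofReal_le_ofReal (le_trans (le_of_eq ?_) (hfeas k))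
          simp only [hA, hc, norm_sub_rev]
        have hlt : (⨅ τ : ℝ, cvarObjective
            ((mixedPlan w ϑ a fun σ : T => (σ : Fin M → Ξ)).map Prod.snd) h α τ) < (δ : EReal) :=
          ((le_iSup₂ (f := fun P (_ : P ∈ multiTransportHyperrectangle Ξ p
            (discreteMeasure ϑ a) ε) => ⨅ τ : ℝ, cvarObjective P h α τ) _ hmem).trans
              hcvar).trans_lt (by exact_mod_cast hδ)
        obtain ⟨τ, hτ⟩ := iInf_lt_iff.1 hlt
        refine ⟨(0, τ), le_rfl, ?_⟩
        have hm : Measurable fun ξ => max (h ξ + τ) 0 := (hh.add_const τ).max measurable_const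
        have hB0 : 0 ≤ B τ := Finset.sum_nonneg fun σ _ => mul_nonneg (hw σ)
          (Finset.sum_nonneg fun l _ => mul_nonneg (hϑ0 l) (le_max_right _ _))
        rw [cvarObjective, lintegral_map hm.ennreal_ofReal measurable_snd,
          lintegral_mixedPlan hw hϑ0 (G := fun z : Ξ × Ξ => max (h z.2 + τ) 0)
            (hm.comp measurable_snd) (fun z => le_max_right _ _),
          EReal.coe_ennreal_ofReal, max_eq_left hB0, ← EReal.coe_sub,
          EReal.coe_lt_coe_iff] at hτ
        rw [hsplit]
        simpa using hτ
      · push Not at hfeas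
        obtain ⟨k, hk⟩ := hfeas
        have hd : 0 < A k - b k := sub_pos.2 hk
        -- The multiplier of the violated budget is scaled so that the penalty offsets `B 0` at `τ =
        -- 0`.
        refine ⟨(Pi.single k (max (B 0) 0 / (A k - b k)), 0), ?_, ?_⟩
        · exact Pi.single_nonneg.2 (div_nonneg (le_max_right _ _) hd.le)
        · have hsum : ∑ i, (Pi.single k (max (B 0) 0 / (A k - b k)) : Fin n → ℝ) i * (b i - A i) =
              -max (B 0) 0 := by
            rw [Finset.sum_eq_single k (fun i _ hi => by rw [Pi.single_eq_of_ne hi, zero_mul])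
              (fun hk => absurd (Finset.mem_univ k) hk), Pi.single_eq_same,
              ← neg_sub (A k), mul_neg, div_mul_cancel₀ _ hd.ne']
          rw [hsplit, hsum]
          have := le_max_left (B 0) 0
          linarith)
  obtain ⟨s, hs, hbud, hpen⟩ := exists_epigraph_of_cvarLagrangian_nonpos hϑ hca hz
  exact ⟨lam, τ, s, hlam, hs, hbud, fun l => penalizedSup_le_iff.2 (hpen l)⟩

end Duality

/-! ### Convexity of the constraints -/

section Convexity

variable {X : Type*} [AddCommGroup X] [Module ℝ X] {n M I : ℕ} {E : Fin n → Type*}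
  [∀ k, NormedAddCommGroup (E k)] {Ξ : Set (∀ k, E k)} {𝒳 : Set X} {p α : ℝ} {ε : Fin n → ℝ}
  {ϑ : Fin M → ℝ} {a : Fin M → Ξ}

/-- For fixed `ξ` the expression is linear in `(λ, τ)` apart from the value of `h`, so only that
value needs a convexity inequality. -/
theorem penalized_convexCombination_le {h h₁ h₂ u v t₁ t₂ τ₁ τ₂ : ℝ} {lam₁ lam₂ e : Fin n → ℝ}
    (hu : 0 ≤ u) (hv : 0 ≤ v) (hh : h ≤ u * h₁ + v * h₂)
    (H₁ : h₁ + τ₁ - ∑ k, lam₁ k * e k ≤ t₁) (H₂ : h₂ + τ₂ - ∑ k, lam₂ k * e k ≤ t₂) :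
    h + (u * τ₁ + v * τ₂) - ∑ k, (u * lam₁ k + v * lam₂ k) * e k ≤ u * t₁ + v * t₂ := by
  have hlin : ∑ k, (u * lam₁ k + v * lam₂ k) * e k =
      u * ∑ k, lam₁ k * e k + v * ∑ k, lam₂ k * e k := by
    rw [Finset.mul_sum, Finset.mul_sum, ← Finset.sum_add_distrib]
    exact Finset.sum_congr rfl fun k _ => by ring
  have h1 := mul_le_mul_of_nonneg_left H₁ hu
  have h2 := mul_le_mul_of_nonneg_left H₂ hv
  rw [hlin]
  linarith

theorem budgetFun_convexCombination (u v : ℝ) (lam₁ lam₂ : Fin n → ℝ) (τ₁ τ₂ : ℝ)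
    (s₁ s₂ : Fin M → ℝ) :
    budgetFun p ε ϑ α (u • lam₁ + v • lam₂) (u • τ₁ + v • τ₂) (u • s₁ + v • s₂) =
      u * budgetFun p ε ϑ α lam₁ τ₁ s₁ + v * budgetFun p ε ϑ α lam₂ τ₂ s₂ := by
  simp only [budgetFun, Pi.add_apply, Pi.smul_apply, smul_eq_mul, mul_add, mul_sub, add_mul,
    Finset.sum_add_distrib, Finset.mul_sum]
  have h1 : ∀ (u : ℝ) (s : Fin M → ℝ), ∑ l, ϑ l * (u * s l) = ∑ l, u * (ϑ l * s l) :=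
    fun u s => Finset.sum_congr rfl fun l _ => by ring
  simp only [h1, mul_assoc]
  ring

theorem convexOn_budgetFun (h𝒳 : Convex ℝ 𝒳) :
    ConvexOn ℝ (𝒳 ×ˢ univ) (fun z : X × (Fin n → ℝ) × ℝ × (Fin M → ℝ) =>
      budgetFun p ε ϑ α z.2.1 z.2.2.1 z.2.2.2) :=
  ⟨h𝒳.prod convex_univ, fun _ _ _ _ u v _ _ _ => (budgetFun_convexCombination u v ..).le⟩

theorem eConvexOn_penalizedSup_sub {f : X → Ξ → ℝ} (hf : ∀ ξ, ConvexOn ℝ 𝒳 fun x => f x ξ)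
    (ζ : Ξ) (l : Fin M) :
    EConvexOn (𝒳 ×ˢ univ) (fun z : X × (Fin n → ℝ) × ℝ × (Fin M → ℝ) =>
      penalizedSup p (f z.1) ζ z.2.1 z.2.2.1 - ((z.2.2.2 l : ℝ) : EReal)) := by
  -- Since `s` is finite, it can be moved across even when `φ` is infinite.
  have hiff : ∀ (φ : EReal) (s t : ℝ), φ - (s : EReal) ≤ t ↔ φ ≤ ((t + s : ℝ) : EReal) := by
    intro φ s t
    rw [EReal.coe_add]
    exact EReal.sub_le_iff_le_add (Or.inl (EReal.coe_ne_bot s)) (Or.inl (EReal.coe_ne_top s))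
  rintro ⟨⟨x, lam, τ, s⟩, t⟩ ⟨⟨hx, -⟩, H⟩ ⟨⟨x', lam', τ', s'⟩, t'⟩ ⟨⟨hx', -⟩, H'⟩ u v hu hv huv
  rw [hiff, penalizedSup_le_iff] at H H'
  refine ⟨⟨(hf ζ).1 hx hx' hu hv huv, mem_univ _⟩, ?_⟩
  rw [hiff, penalizedSup_le_iff]
  intro ξ
  refine (penalized_convexCombination_le hu hv ((hf ξ).2 hx hx' hu hv huv) (H ξ)
    (H' ξ)).trans (le_of_eq ?_)
  simp only [Prod.snd_add, Prod.smul_snd, Prod.fst_add, Prod.smul_fst, Pi.add_apply,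
    Pi.smul_apply, smul_eq_mul]
  ring

theorem convex_epiFeasibleSet (h𝒳 : Convex ℝ 𝒳) {f : Fin I → X → Ξ → ℝ} {α : Fin I → ℝ}
    (hf : ∀ i, ∀ ξ, ConvexOn ℝ 𝒳 fun x => f i x ξ) :
    Convex ℝ (epiFeasibleSet 𝒳 p ε ϑ a f α) := by
  rintro ⟨x, lam, τ, s⟩ ⟨hx, H⟩ ⟨x', lam', τ', s'⟩ ⟨hx', H'⟩ u v hu hv huv
  refine ⟨h𝒳 hx hx' hu hv huv, fun i => ?_⟩
  obtain ⟨h1, h2, h3, h4⟩ := H i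
  obtain ⟨h1', h2', h3', h4'⟩ := H' i
  refine ⟨fun k => add_nonneg (mul_nonneg hu (h1 k)) (mul_nonneg hv (h1' k)),
    fun l => add_nonneg (mul_nonneg hu (h2 l)) (mul_nonneg hv (h2' l)), ?_, fun l => ?_⟩
  · have hB := budgetFun_convexCombination (p := p) (ε := ε) (ϑ := ϑ) (α := α i) u v
      (lam i) (lam' i) (τ i) (τ' i) (s i) (s' i)
    have hB1 : budgetFun p ε ϑ (α i) (lam i) (τ i) (s i) ≤ 0 := sub_nonpos.2 h3
    have hB2 : budgetFun p ε ϑ (α i) (lam' i) (τ' i) (s' i) ≤ 0 := sub_nonpos.2 h3'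
    refine sub_nonpos.1 (hB.trans_le ?_)
    have := mul_nonpos_of_nonneg_of_nonpos hu hB1
    have := mul_nonpos_of_nonneg_of_nonpos hv hB2
    linarith
  · rw [penalizedSup_le_iff]
    exact fun ξ => penalized_convexCombination_le hu hv ((hf i ξ).2 hx hx' hu hv huv)
      (penalizedSup_le_iff.1 (h4 l) ξ) (penalizedSup_le_iff.1 (h4' l) ξ)

end Convexity

/-! ### Projecting out the auxiliary variables -/

section Projection

variable {X Y : Type*} {S : Set (X × Y)} {φ : X → ℝ}

theorem optValue_image_fst :
    optValue (Prod.fst '' S) φ = optValue S fun z => φ z.1 := by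
  simp only [optValue, iInf_image]

theorem isSolution_image_fst {x : X} :
    IsSolution (Prod.fst '' S) φ x ↔ ∃ y, IsSolution S (fun z => φ z.1) (x, y) := by
  constructor
  · rintro ⟨⟨⟨x, y⟩, hz, rfl⟩, hmin⟩
    exact ⟨y, hz, fun w hw => hmin _ ⟨w, hw, rfl⟩⟩
  · rintro ⟨y, hz, hmin⟩
    refine ⟨⟨_, hz, rfl⟩, ?_⟩
    rintro _ ⟨w, hw, rfl⟩
    exact hmin w hw

end Projection

/-! ### Assembly -/

theorem mainTheorem9
    {n M I ℓ : ℕ}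
    -- the factors `ℝ^{d_k}`, each with an arbitrary norm
    {E : Fin n → Type*} [∀ k, NormedAddCommGroup (E k)] [∀ k, NormedSpace ℝ (E k)]
    [∀ k, FiniteDimensional ℝ (E k)] [∀ k, MeasurableSpace (E k)] [∀ k, BorelSpace (E k)]
    (Ξ : Set (∀ k, E k)) (hΞ : IsClosed Ξ)
    (𝒳 : Set (EuclideanSpace ℝ (Fin ℓ))) (h𝒳_closed : IsClosed 𝒳) (h𝒳_convex : Convex ℝ 𝒳)
    (g : EuclideanSpace ℝ (Fin ℓ))
    (p : ℝ) (hp : 1 ≤ p)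
    (ε : Fin n → ℝ) (hε : ∀ k, 0 < ε k)
    -- the discrete reference distribution
    (ϑ : Fin M → ℝ) (hϑ_pos : ∀ l, 0 < ϑ l) (hϑ_sum : ∑ l, ϑ l = 1) (a : Fin M → Ξ)
    (Q : Measure Ξ) (hQ : Q = discreteMeasure ϑ a)
    -- the constraint functions
    (f : Fin I → EuclideanSpace ℝ (Fin ℓ) → Ξ → ℝ)
    (α : Fin I → ℝ) (hα : ∀ i, 0 < α i ∧ α i < 1)
    (hf_convex : ∀ i, ∀ ξ : Ξ, ConvexOn ℝ 𝒳 (fun x => f i x ξ))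
    (hf_growth : ∃ r : ℝ, 0 ≤ r ∧ r < p ∧
      ∀ i, ∀ x ∈ 𝒳, Continuous (f i x) ∧ Growth r (f i x)) :
    -- each single constraint
    (∀ i,
      cvarFeasibleSet 𝒳 (multiTransportHyperrectangle Ξ p Q ε) (f i) (α i) =
          {x | x ∈ 𝒳 ∧ ∃ (lam : Fin n → ℝ) (τ : ℝ) (s : Fin M → ℝ),
            EpiConstraints p ε ϑ a (α i) (f i x) lam τ s} ∧
      -- the constraints are convex in `(x, λ, τ, s)`
      ConvexOn ℝ (𝒳 ×ˢ univ)
          (fun z : EuclideanSpace ℝ (Fin ℓ) × (Fin n → ℝ) × ℝ × (Fin M → ℝ) =>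
            budgetFun p ε ϑ (α i) z.2.1 z.2.2.1 z.2.2.2) ∧
      ∀ l, EConvexOn (𝒳 ×ˢ univ)
          (fun z : EuclideanSpace ℝ (Fin ℓ) × (Fin n → ℝ) × ℝ × (Fin M → ℝ) =>
            penalizedSup p (f i z.1) (a l) z.2.1 z.2.2.1 - ((z.2.2.2 l : ℝ) : EReal))) ∧
    -- the problem with all constraints is equivalent to the epigraphical convex program
    (drccpFeasibleSet 𝒳 (multiTransportHyperrectangle Ξ p Q ε) f α =
        Prod.fst '' epiFeasibleSet 𝒳 p ε ϑ a f α ∧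
      Convex ℝ (epiFeasibleSet 𝒳 p ε ϑ a f α) ∧
      optValue (drccpFeasibleSet 𝒳 (multiTransportHyperrectangle Ξ p Q ε) f α)
          (fun x => inner ℝ g x) =
        optValue (epiFeasibleSet 𝒳 p ε ϑ a f α) (fun z => inner ℝ g z.1) ∧
      ∀ x, IsSolution (drccpFeasibleSet 𝒳 (multiTransportHyperrectangle Ξ p Q ε) f α)
          (fun x => inner ℝ g x) x ↔
        ∃ y, IsSolution (epiFeasibleSet 𝒳 p ε ϑ a f α) (fun z => inner ℝ g z.1) (x, y)) := by
  subst hQ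
  obtain ⟨r, -, -, hcont⟩ := hf_growth
  have hmeas : ∀ i, ∀ x ∈ 𝒳, Measurable (f i x) := fun i x hx => by
    -- Second countability makes the product σ-algebra Borel, so continuity gives measurability.
    have : ∀ k, SecondCountableTopology (E k) := fun k => by
      have : ProperSpace (E k) := FiniteDimensional.proper ℝ (E k)
      infer_instance
    exact (hcont i x hx).1.measurable
  have hiff : ∀ i, ∀ x ∈ 𝒳,
      (worstCaseCVaR (multiTransportHyperrectangle Ξ p (discreteMeasure ϑ a) ε) (f i x) (α i) ≤ 0 ↔
        ∃ (lam : Fin n → ℝ) (τ : ℝ) (s : Fin M → ℝ),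
          EpiConstraints p ε ϑ a (α i) (f i x) lam τ s) := fun i x hx =>
    ⟨exists_epiConstraints_of_worstCaseCVaR_nonpos (by linarith) (hmeas i x hx) hϑ_pos hϑ_sum hε
      (hα i).1 (hα i).2, fun ⟨_, _, _, h⟩ => worstCaseCVaR_nonpos_of_epiConstraints (hmeas i x hx)
        (fun l => (hϑ_pos l).le) (fun k => (hε k).le) h⟩
  have hproj : drccpFeasibleSet 𝒳 (multiTransportHyperrectangle Ξ p (discreteMeasure ϑ a) ε) f α =
      Prod.fst '' epiFeasibleSet 𝒳 p ε ϑ a f α := by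
    ext x
    constructor
    · rintro ⟨hx, H⟩
      -- The constraints share only `x`, so multipliers are chosen separately for each `i`.
      choose lam τ s hepi using fun i => (hiff i x hx).1 (H i)
      exact ⟨(x, lam, τ, s), ⟨hx, hepi⟩, rfl⟩
    · rintro ⟨⟨x, lam, τ, s⟩, ⟨hx, H⟩, rfl⟩
      exact ⟨hx, fun i => (hiff i x hx).2 ⟨_, _, _, H i⟩⟩
  refine ⟨fun i => ⟨?_, convexOn_budgetFun h𝒳_convex,
    fun l => eConvexOn_penalizedSup_sub (hf_convex i) (a l) l⟩, hproj,
    convex_epiFeasibleSet h𝒳_convex hf_convex, ?_, fun x => ?_⟩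
  · ext x
    exact and_congr_right fun hx => hiff i x hx
  · rw [hproj]
    exact optValue_image_fst (φ := fun x => inner ℝ g x)
  · rw [hproj]
    exact isSolution_image_fst (φ := fun x => inner ℝ g x)
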